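/- For $s\in\mathbb R$ and $1\le p\le\infty$ let $\|u\|_{W^{s,p}}=\|(1-\Delta)^{s/2}u\|_{L^p(\mathbb R^d)}$ be the inhomogeneous Sobolev (Bessel potential) norm, where $(1-\Delta)^{s/2}$ acts on tempered distributions as a Fourier multiplier, and let $H^s=W^{s,2}$. Put $s_c=\frac d2-1$, $s_\epsilon=s_c+\epsilon$ and $r_\epsilon=\frac{2d}{d+2(1-\epsilon)}$. (i) Let $d\ge 3$ and $0<\epsilon<\frac{d+2}{2}$ (the range of $\epsilon>0$ for which $r_\epsilon$ is a finite positive exponent). There is a constant $C=C(d,\epsilon)$ such that for every $\phi\in H^{s_\epsilon}(\mathbb R^d)$ the function $|\phi|^2\phi$ belongs to $W^{-(s_c+\frac\epsilon2),r_\epsilon}(\mathbb R^d)$ and $$\big\||\phi|^2\phi\big\|_{W^{-(s_c+\frac{\epsilon}{2}),r_\epsilon}}\le C\,\|\phi\|_{H^{s_\epsilon}}^3.$$ (ii) Let $d=2$ and $0<\epsilon<\frac29$. There is a constant $C=C(\epsilon)$ such that for every $\phi\in H^{1/3}(\mathbb R^2)$ the function $|\phi|^2\phi$ belongs to $W^{-(\frac13-\frac\epsilon2),r_\epsilon}(\mathbb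 R^2)$, where $r_\epsilon=\frac{2}{2-\epsilon}$, and $$\big\||\phi|^2\phi\big\|_{W^{-(\frac13-\frac{\epsilon}{2}),r_\epsilon}}\le C\,\|\phi\|_{H^{1/3}}^3.$$ -/

import Mathlib

open MeasureTheory
open scoped ENNReal NNReal SchwartzMap FourierTransform

namespace CubicSobolev

/-- `ℝ^d` with its Euclidean norm and Lebesgue measure. -/
abbrev Space (d : ℕ) : Type := EuclideanSpace ℝ (Fin d)

/-- The symbol `(1 + |2πξ|²)^(s/2)` of `(1 - Δ)^(s/2)`, for the Fourier transform
`𝓕 f ξ = ∫ exp(-2πi x·ξ) f x dx`. -/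
noncomputable def besselSymbol (d : ℕ) (s : ℝ) (ξ : Space d) : ℂ :=
  (((1 + ‖(2 * Real.pi) • ξ‖ ^ 2) ^ (s / 2) : ℝ) : ℂ)

/-- The symbol is smooth with derivatives of polynomial growth, so that the multiplier with this
symbol is the genuine one. -/
theorem besselSymbol_hasTemperateGrowth (d : ℕ) (s : ℝ) :
    (besselSymbol d s).HasTemperateGrowth := by
  have h1 : (fun ξ : Space d => (2 * Real.pi) • ξ).HasTemperateGrowth := by fun_prop
  have h2 := (Function.hasTemperateGrowth_one_add_norm_sq_rpow (Space d) (s / 2)).comp h1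
  have h3 : (fun ξ : Space d =>
      (((1 + ‖(2 * Real.pi) • ξ‖ ^ 2) ^ (s / 2) : ℝ) : ℂ)).HasTemperateGrowth := by
    have h2' : (fun ξ : Space d =>
      ((1 + ‖(2 * Real.pi) • ξ‖ ^ 2) ^ (s / 2) : ℝ)).HasTemperateGrowth := h2
    fun_prop
  exact h3

/-- The operator `(1 - Δ)^(s/2)` on the tempered distributions on `ℝ^d`. -/
noncomputable def bessel (d : ℕ) (s : ℝ) : 𝓢'(Space d, ℂ) →L[ℂ] 𝓢'(Space d, ℂ) :=
  TemperedDistribution.fourierMultiplierCLM ℂ (besselSymbol d s)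

/-- The tempered distribution `T` is given by the function `u`: for every Schwartz function `g`,
the integral `∫ g u` converges absolutely and equals `T g`. -/
def IsGivenBy {d : ℕ} (T : 𝓢'(Space d, ℂ)) (u : Space d → ℂ) : Prop :=
  ∀ g : 𝓢(Space d, ℂ), Integrable (fun x => g x * u x) ∧ T g = ∫ x, g x * u x

/-- `v` is the function `(1 - Δ)^(s/2) u`, in the sense of tempered distributions. -/
def IsBesselOf {d : ℕ} (s : ℝ) (u v : Space d → ℂ) : Prop :=
  ∃ T : 𝓢'(Space d, ℂ), IsGivenBy T u ∧ IsGivenBy (bessel d s T) v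

/-- The function `u` belongs to the Sobolev space `W^{s,p}(ℝ^d)`: it defines a tempered
distribution, and `(1 - Δ)^(s/2) u` is a function in `L^p`. -/
def MemW {d : ℕ} (s : ℝ) (p : ℝ≥0∞) (u : Space d → ℂ) : Prop :=
  ∃ v : Space d → ℂ, MemLp v p ∧ IsBesselOf s u v

/-- The norm `‖u‖_{W^{s,p}} = ‖(1 - Δ)^(s/2) u‖_{L^p}`, which is `∞` if `u ∉ W^{s,p}`. The function
`(1 - Δ)^(s/2) u` is determined almost everywhere, so the infimum is over one value at most. -/
noncomputable def normW {d : ℕ} (s : ℝ) (p : ℝ≥0∞) (u : Space d → ℂ) : ℝ≥0∞ :=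
  ⨅ (v : Space d → ℂ) (_ : MemLp v p ∧ IsBesselOf s u v), eLpNorm v p volume

/-- `u ∈ H^s = W^{s,2}`. -/
def MemH {d : ℕ} (s : ℝ) (u : Space d → ℂ) : Prop := MemW s 2 u

/-- The norm of `H^s = W^{s,2}`. -/
noncomputable def normH {d : ℕ} (s : ℝ) (u : Space d → ℂ) : ℝ≥0∞ := normW s 2 u

/-- The cubic nonlinearity `|φ|² φ`. -/
noncomputable def cubic {d : ℕ} (φ : Space d → ℂ) : Space d → ℂ :=
  fun x => ((‖φ x‖ ^ 2 : ℝ) : ℂ) * φ x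

/-- The critical regularity `s_c = d/2 - 1`. -/
noncomputable def sCrit (d : ℕ) : ℝ := (d : ℝ) / 2 - 1

/-- The real number `r_ε = 2d / (d + 2(1 - ε))`. -/
noncomputable def rExp (d : ℕ) (ε : ℝ) : ℝ := 2 * (d : ℝ) / ((d : ℝ) + 2 * (1 - ε))

end CubicSobolev

/-!
Since `‖|φ|²φ‖_{L^q} = ‖φ‖³_{L^{3q}}`, the cubic estimate is the composition of the Sobolev
embedding `H^s ⊂ L^{3q}` with the smoothing `(1 - Δ)^(-σ/2) : L^q → L^r`, for a suitable `q`.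

* Sobolev embedding (Chemin–Xu): at each height `t`, split `u` in frequency at a radius `R(t)` for
  which the low part is at most `t / 2` pointwise, by Cauchy–Schwarz. Then `{|u| > t}` is controlled
  by the high part in `L²`, by Chebyshev and Plancherel, and integrating over `t` gives the strong
  estimate, critical exponent included.
* Smoothing off the endpoint: the kernel of `(1 - Δ)^(-σ/2)` is a superposition of heat kernels, so
  it is `O(|x|^(-a))` for every positive `a > d - σ`. This puts it in the `L^m` that Young's
  inequality asks for.
-/

namespace CubicSobolev

section Young

open scoped Convolution

theorem rpow_rpow_mul_rpow_rpow_eq_self {c a b : ℝ} (ha : 0 ≤ a) (hb : 0 ≤ b)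
    (h : c * (a + b) = 1) (z : ℝ≥0∞) : (z ^ c) ^ a * (z ^ c) ^ b = z := by
  rw [← ENNReal.rpow_add_of_nonneg _ _ ha hb, ← ENNReal.rpow_mul, h, ENNReal.rpow_one]

theorem lintegral_mul_rpow_le {α : Type*} [MeasurableSpace α] {μ : Measure α} {f g : α → ℝ≥0∞}
    (hf : AEMeasurable f μ) (hg : AEMeasurable g μ) {p q r : ℝ} (hp : 1 ≤ p) (hq : 1 ≤ q)
    (hr : 0 < r) (h : 1 / p + 1 / q = 1 + 1 / r) :
    (∫⁻ x, f x * g x ∂μ) ^ r ≤ (∫⁻ x, f x ^ p * g x ^ q ∂μ) *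
      ((∫⁻ x, f x ^ p ∂μ) ^ (r / p - 1) * (∫⁻ x, g x ^ q ∂μ) ^ (r / q - 1)) := by
  have hp0 : 0 < p := by linarith
  have hq0 : 0 < q := by linarith
  have hr' : 0 ≤ 1 / r := by positivity
  have ha : 0 ≤ 1 / p - 1 / r := by linarith [(div_le_one hq0).2 hq]
  have hb : 0 ≤ 1 / q - 1 / r := by linarith [(div_le_one hp0).2 hp]
  have factor : ∀ x, f x * g x = (f x ^ p * g x ^ q) ^ (1 / r) *
      (f x ^ p) ^ (1 / p - 1 / r) * (g x ^ q) ^ (1 / q - 1 / r) := fun x => by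
    conv_lhs => rw [← rpow_rpow_mul_rpow_rpow_eq_self (c := p) hr' ha (by field_simp; ring) (f x),
      ← rpow_rpow_mul_rpow_rpow_eq_self (c := q) hr' hb (by field_simp; ring) (g x)]
    rw [ENNReal.mul_rpow_of_nonneg _ _ hr']
    ring
  have hölder := ENNReal.lintegral_prod_norm_pow_le (μ := μ) (Finset.univ : Finset (Fin 3))
    (f := ![fun x => f x ^ p * g x ^ q, fun x => f x ^ p, fun x => g x ^ q])
    (by simpa [Fin.forall_fin_succ] using
      ⟨(hf.pow_const p).mul (hg.pow_const q), hf.pow_const p, hg.pow_const q⟩)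
    (p := ![1 / r, 1 / p - 1 / r, 1 / q - 1 / r])
    (by simp only [Fin.sum_univ_three, Matrix.cons_val]; linarith)
    (by simpa only [Finset.mem_univ, Fin.forall_fin_succ, Fin.forall_fin_zero_pi, forall_const]
      using! ⟨hr', ha, hb, by simp⟩)
  simp only [Fin.prod_univ_three, Matrix.cons_val, ← factor] at hölder
  refine (ENNReal.rpow_le_rpow hölder hr.le).trans_eq ?_
  have e : ∀ c : ℝ, (1 / c - 1 / r) * r = r / c - 1 := fun c => by field_simp
  rw [ENNReal.mul_rpow_of_nonneg _ _ hr.le, ENNReal.mul_rpow_of_nonneg _ _ hr.le,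
    ← ENNReal.rpow_mul, ← ENNReal.rpow_mul, ← ENNReal.rpow_mul,
    one_div_mul_cancel hr.ne', ENNReal.rpow_one, e, e, mul_assoc]

theorem lintegral_enorm_convolution_integrand_le {𝕜 E E' F G : Type*} [NontriviallyNormedField 𝕜]
    [NormedAddCommGroup E] [NormedAddCommGroup E'] [NormedAddCommGroup F] [NormedSpace 𝕜 E]
    [NormedSpace 𝕜 E'] [NormedSpace 𝕜 F] [Sub G] [MeasurableSpace G] {μ : Measure G}
    (L : E →L[𝕜] E' →L[𝕜] F) (f : G → E) (g : G → E') (x : G) :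
    ∫⁻ t, ‖L (f t) (g (x - t))‖ₑ ∂μ ≤ ‖L‖ₑ * ∫⁻ t, ‖f t‖ₑ * ‖g (x - t)‖ₑ ∂μ := by
  rw [← lintegral_const_mul' _ _ enorm_ne_top]
  refine lintegral_mono fun t => ?_
  simpa only [mul_assoc] using L.le_opENorm₂ (f t) (g (x - t))

variable {G : Type*} [AddGroup G] [MeasurableSpace G] [MeasurableAdd₂ G] [MeasurableNeg G]
  {μ : Measure G} [SFinite μ] [μ.IsAddLeftInvariant] [μ.IsAddRightInvariant]

theorem lintegral_lintegral_mul_sub {f g : G → ℝ≥0∞} (hf : AEMeasurable f μ)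
    (hg : AEMeasurable g μ) :
    ∫⁻ x, ∫⁻ t, f t * g (x - t) ∂μ ∂μ = (∫⁻ x, f x ∂μ) * ∫⁻ x, g x ∂μ := by
  have hmeas : AEMeasurable (fun z : G × G => f z.2 * g (z.1 - z.2)) (μ.prod μ) :=
    hf.comp_snd.mul (hg.comp_quasiMeasurePreserving (quasiMeasurePreserving_sub μ μ))
  rw [lintegral_lintegral_swap hmeas, ← lintegral_mul_const'' _ hf]
  refine lintegral_congr fun t => ?_
  have hgt : AEMeasurable (fun x => g (x - t)) μ :=
    hg.comp_quasiMeasurePreserving (measurePreserving_sub_right μ t).quasiMeasurePreserving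
  rw [lintegral_const_mul'' _ hgt, lintegral_sub_right_eq_self g t]

variable [μ.IsNegInvariant] {p q r : ℝ}

theorem lintegral_lintegral_mul_sub_rpow_le {f g : G → ℝ≥0∞} (hf : AEMeasurable f μ)
    (hg : AEMeasurable g μ) (hp : 1 ≤ p) (hq : 1 ≤ q) (hr : 0 < r)
    (h : 1 / p + 1 / q = 1 + 1 / r) :
    ∫⁻ x, (∫⁻ t, f t * g (x - t) ∂μ) ^ r ∂μ ≤
      (∫⁻ x, f x ^ p ∂μ) ^ (r / p) * (∫⁻ x, g x ^ q ∂μ) ^ (r / q) := by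
  set A := ∫⁻ x, f x ^ p ∂μ
  set B := ∫⁻ x, g x ^ q ∂μ
  have pointwise : ∀ x, (∫⁻ t, f t * g (x - t) ∂μ) ^ r ≤
      (∫⁻ t, f t ^ p * g (x - t) ^ q ∂μ) * (A ^ (r / p - 1) * B ^ (r / q - 1)) := fun x => by
    have hgx : AEMeasurable (fun t => g (x - t)) μ :=
      hg.comp_quasiMeasurePreserving (quasiMeasurePreserving_sub_left μ x)
    simpa only [lintegral_sub_left_eq_self (fun t => g t ^ q) x] using
      lintegral_mul_rpow_le hf hgx hp hq hr h
  have absorb : ∀ {c : ℝ} (_ : 1 ≤ c) (_ : 1 / r ≤ 1 / c) (z : ℝ≥0∞),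
      z * z ^ (r / c - 1) = z ^ (r / c) := fun {c} hc hcr z => by
    have hrc : 0 ≤ r / c - 1 := by
      rw [sub_nonneg, one_le_div (by linarith)]
      exact (one_div_le_one_div hr (by linarith)).1 hcr
    nth_rw 1 [← ENNReal.rpow_one z]
    rw [← ENNReal.rpow_add_of_nonneg _ _ zero_le_one hrc, add_sub_cancel]
  have hp' : 1 / p ≤ 1 := (div_le_one (by linarith)).2 hp
  have hq' : 1 / q ≤ 1 := (div_le_one (by linarith)).2 hq
  have hmeas : AEMeasurable (fun z : G × G => f z.2 ^ p * g (z.1 - z.2) ^ q) (μ.prod μ) :=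
    (hf.comp_snd.pow_const p).mul
      ((hg.comp_quasiMeasurePreserving (quasiMeasurePreserving_sub μ μ)).pow_const q)
  calc ∫⁻ x, (∫⁻ t, f t * g (x - t) ∂μ) ^ r ∂μ
      ≤ ∫⁻ x, (∫⁻ t, f t ^ p * g (x - t) ^ q ∂μ) * (A ^ (r / p - 1) * B ^ (r / q - 1)) ∂μ :=
        lintegral_mono pointwise
    _ = A * B * (A ^ (r / p - 1) * B ^ (r / q - 1)) := by
        rw [lintegral_mul_const'' _ hmeas.lintegral_prod_right',
          lintegral_lintegral_mul_sub (hf.pow_const p) (hg.pow_const q)]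
    _ = A ^ (r / p) * B ^ (r / q) := by
        rw [mul_mul_mul_comm, absorb hp (by linarith), absorb hq (by linarith)]

theorem eLpNorm_lintegral_mul_sub_le {f g : G → ℝ≥0∞} (hf : AEMeasurable f μ)
    (hg : AEMeasurable g μ) (hp : 1 ≤ p) (hq : 1 ≤ q) (hr : 0 < r)
    (h : 1 / p + 1 / q = 1 + 1 / r) :
    eLpNorm (fun x => ∫⁻ t, f t * g (x - t) ∂μ) (.ofReal r) μ ≤
      eLpNorm f (.ofReal p) μ * eLpNorm g (.ofReal q) μ := by
  have eLpNorm_eq : ∀ {c : ℝ} (_ : 0 < c) (f : G → ℝ≥0∞),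
      eLpNorm f (.ofReal c) μ = (∫⁻ x, f x ^ c ∂μ) ^ (1 / c) := fun {c} hc f => by
    rw [eLpNorm_eq_lintegral_rpow_enorm_toReal (by simpa using hc) ENNReal.ofReal_ne_top,
      ENNReal.toReal_ofReal hc.le]
    simp only [enorm_eq_self]
  have hr' : 0 ≤ 1 / r := by positivity
  rw [eLpNorm_eq hr, eLpNorm_eq (by linarith : 0 < p), eLpNorm_eq (by linarith : 0 < q)]
  refine (ENNReal.rpow_le_rpow (lintegral_lintegral_mul_sub_rpow_le hf hg hp hq hr h) hr').trans_eq
    ?_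
  rw [ENNReal.mul_rpow_of_nonneg _ _ hr', ← ENNReal.rpow_mul, ← ENNReal.rpow_mul,
    div_mul_div_cancel₀' hr.ne', div_mul_div_cancel₀' hr.ne']

section Normed

variable {𝕜 E E' F : Type*} [NontriviallyNormedField 𝕜] [NormedAddCommGroup E]
  [NormedAddCommGroup E'] [NormedAddCommGroup F] [NormedSpace 𝕜 E] [NormedSpace 𝕜 E']
  [NormedSpace 𝕜 F] (L : E →L[𝕜] E' →L[𝕜] F) {f : G → E} {g : G → E'}

theorem ae_convolutionExistsAt (hp : 1 ≤ p) (hq : 1 ≤ q) (hr : 0 < r)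
    (h : 1 / p + 1 / q = 1 + 1 / r) (hf : MemLp f (.ofReal p) μ) (hg : MemLp g (.ofReal q) μ) :
    ∀ᵐ x ∂μ, ConvolutionExistsAt f g x L μ := by
  have hmeas : AEMeasurable (fun x => ∫⁻ t, ‖f t‖ₑ * ‖g (x - t)‖ₑ ∂μ) μ :=
    (hf.1.enorm.comp_snd.mul (hg.1.enorm.comp_quasiMeasurePreserving
      (quasiMeasurePreserving_sub μ μ))).lintegral_prod_right'
  have young := eLpNorm_lintegral_mul_sub_le hf.1.enorm hg.1.enorm hp hq hr h
  simp only [eLpNorm_enorm] at young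
  have hfin := lintegral_rpow_enorm_lt_top_of_eLpNorm_lt_top (by simpa using hr)
    ENNReal.ofReal_ne_top (young.trans_lt (ENNReal.mul_lt_top hf.2 hg.2))
  simp only [enorm_eq_self, ENNReal.toReal_ofReal hr.le] at hfin
  filter_upwards [ae_lt_top' (hmeas.pow_const r) hfin.ne] with x hx
  refine ⟨hf.1.convolution_integrand_snd L hg.1 x, ?_⟩
  exact (lintegral_enorm_convolution_integrand_le L f g x).trans_lt
    (ENNReal.mul_lt_top enorm_lt_top ((ENNReal.rpow_lt_top_iff_of_pos hr).1 hx))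

theorem eLpNorm_convolution_le [NormedSpace ℝ F] (hp : 1 ≤ p) (hq : 1 ≤ q) (hr : 0 < r)
    (h : 1 / p + 1 / q = 1 + 1 / r) (hf : AEStronglyMeasurable f μ)
    (hg : AEStronglyMeasurable g μ) :
    eLpNorm (f ⋆[L, μ] g) (.ofReal r) μ ≤
      ‖L‖ₑ * (eLpNorm f (.ofReal p) μ * eLpNorm g (.ofReal q) μ) := by
  have young := eLpNorm_lintegral_mul_sub_le hf.enorm hg.enorm hp hq hr h
  simp only [eLpNorm_enorm] at young
  refine (eLpNorm_le_nnreal_smul_eLpNorm_of_ae_le_mul' (c := ‖L‖₊) ?_ _).trans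
    (mul_le_mul_right young _)
  exact .of_forall fun x => (enorm_integral_le_lintegral_enorm _).trans
    (lintegral_enorm_convolution_integrand_le L f g x)

theorem memLp_convolution [NormedSpace ℝ F] (hp : 1 ≤ p) (hq : 1 ≤ q) (hr : 0 < r)
    (h : 1 / p + 1 / q = 1 + 1 / r) (hf : MemLp f (.ofReal p) μ) (hg : MemLp g (.ofReal q) μ) :
    MemLp (f ⋆[L, μ] g) (.ofReal r) μ :=
  ⟨(hf.1.convolution_integrand L hg.1).integral_prod_right',
    (eLpNorm_convolution_le L hp hq hr h hf.1 hg.1).trans_lt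
      (ENNReal.mul_lt_top enorm_lt_top (ENNReal.mul_lt_top hf.2 hg.2))⟩

end Normed

theorem integrable_mul_convolution_integrand {𝕜 : Type*} [RCLike 𝕜] {φ f g : G → 𝕜} {r' : ℝ≥0∞}
    [hr' : (ENNReal.ofReal r).HolderConjugate r'] (hp : 1 ≤ p) (hq : 1 ≤ q)
    (h : 1 / p + 1 / q = 1 + 1 / r) (hφ : MemLp φ r' μ) (hf : MemLp f (.ofReal p) μ)
    (hg : MemLp g (.ofReal q) μ) :
    Integrable (fun z : G × G => φ z.1 * (f z.2 * g (z.1 - z.2))) (μ.prod μ) := by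
  have hr : 0 < r := ENNReal.ofReal_pos.1 hr'.pos
  have hmeas : AEStronglyMeasurable (fun z : G × G => φ z.1 * (f z.2 * g (z.1 - z.2)))
      (μ.prod μ) :=
    hφ.1.comp_fst.mul (hf.1.convolution_integrand (.mul 𝕜 𝕜) hg.1)
  refine (integrable_prod_iff hmeas).2 ⟨?_, ?_⟩
  · filter_upwards [ae_convolutionExistsAt (.mul 𝕜 𝕜) hp hq hr h hf hg] with x hx
    exact hx.const_mul (φ x)
  · simp only [norm_mul, integral_const_mul]
    exact hφ.norm.integrable_mul
      (memLp_convolution (.mul ℝ ℝ) hp hq hr h hf.norm hg.norm)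

end Young

section NormPower

variable {E F : Type*} [NormedAddCommGroup E] [NormedSpace ℝ E] [FiniteDimensional ℝ E]
  [MeasurableSpace E] [BorelSpace E] [NormedAddCommGroup F] {μ : Measure E} [μ.IsAddHaarMeasure]
  {f : E → F} {a b C C' : ℝ}

theorem integrable_of_norm_le_rpow (hd : 1 ≤ Module.finrank ℝ E) (hf : AEStronglyMeasurable f μ)
    (ha : a < Module.finrank ℝ E) (hb : Module.finrank ℝ E < b)
    (hfa : ∀ᵐ x ∂μ, ‖f x‖ ≤ C * ‖x‖ ^ (-a)) (hfb : ∀ᵐ x ∂μ, ‖f x‖ ≤ C' * ‖x‖ ^ (-b)) :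
    Integrable f μ := by
  rw [← integrableOn_univ, ← Set.union_compl_self (Metric.ball (0 : E) 1)]
  refine (integrableOn_ball_of_norm_le_rpow hd ha (ae_restrict_of_ae hfa) hf).union ?_
  have hb0 : 0 ≤ b := (Nat.cast_nonneg _).trans hb.le
  refine ((integrable_one_add_norm hb).const_mul (|C'| * 2 ^ b)).integrableOn.mono' hf.restrict ?_
  filter_upwards [ae_restrict_of_ae hfb, ae_restrict_mem measurableSet_ball.compl] with x hx hx1
  have one_le : 1 ≤ ‖x‖ := by simpa using hx1
  calc ‖f x‖ ≤ |C'| * ‖x‖ ^ (-b) := hx.trans (by gcongr; exact le_abs_self C')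
    _ ≤ |C'| * ((1 + ‖x‖) / 2) ^ (-b) :=
        mul_le_mul_of_nonneg_left (Real.rpow_le_rpow_of_nonpos (by positivity) (by linarith)
          (neg_nonpos.2 hb0)) (abs_nonneg _)
    _ = |C'| * 2 ^ b * (1 + ‖x‖) ^ (-b) := by
        rw [Real.div_rpow (by positivity) two_pos.le, Real.rpow_neg two_pos.le, div_inv_eq_mul]
        ring

theorem memLp_of_norm_le_rpow {m : ℝ} (hd : 1 ≤ Module.finrank ℝ E)
    (hf : AEStronglyMeasurable f μ) (hm : 0 < m) (ha : a * m < Module.finrank ℝ E)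
    (hb : Module.finrank ℝ E < b * m) (hfa : ∀ᵐ x ∂μ, ‖f x‖ ≤ C * ‖x‖ ^ (-a))
    (hfb : ∀ᵐ x ∂μ, ‖f x‖ ≤ C' * ‖x‖ ^ (-b)) :
    MemLp f (.ofReal m) μ := by
  have rpow_le {K e : ℝ} (h : ∀ᵐ x ∂μ, ‖f x‖ ≤ K * ‖x‖ ^ (-e)) :
      ∀ᵐ x ∂μ, ‖‖f x‖ ^ m‖ ≤ |K| ^ m * ‖x‖ ^ (-(e * m)) := by
    filter_upwards [h] with x hx
    have hx' : ‖f x‖ ≤ |K| * ‖x‖ ^ (-e) := hx.trans (by gcongr; exact le_abs_self K)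
    rw [Real.norm_of_nonneg (by positivity)]
    refine (Real.rpow_le_rpow (norm_nonneg _) hx' hm.le).trans_eq ?_
    rw [Real.mul_rpow (abs_nonneg _) (by positivity), ← Real.rpow_mul (norm_nonneg _), neg_mul]
  rw [← integrable_norm_rpow_iff hf (by simpa using hm) ENNReal.ofReal_ne_top,
    ENNReal.toReal_ofReal hm.le]
  exact integrable_of_norm_le_rpow hd
    (hf.norm.aemeasurable.pow_const m).aestronglyMeasurable ha hb (rpow_le hfa) (rpow_le hfb)

end NormPower

section BesselKernel

variable {V : Type*} [NormedAddCommGroup V] [InnerProductSpace ℝ V]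

/-- The heat kernel `(4πt)^(-d/2) exp(-‖x‖² / 4t)` at time `t`, where `d` is the dimension of `V`:
the kernel of `exp(tΔ)`. -/
noncomputable def heatKernel (t : ℝ) (x : V) : ℝ :=
  (4 * Real.pi * t) ^ (-(Module.finrank ℝ V / 2 : ℝ)) * Real.exp (-(4 * t)⁻¹ * ‖x‖ ^ 2)

theorem heatKernel_nonneg {t : ℝ} (ht : 0 < t) (x : V) : 0 ≤ heatKernel t x := by
  unfold heatKernel; positivity

theorem measurable_heatKernel [MeasurableSpace V] [OpensMeasurableSpace V] :
    Measurable fun z : ℝ × V => heatKernel z.1 z.2 := by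
  unfold heatKernel
  fun_prop

theorem heatKernel_le_rpow {t b : ℝ} (ht : 0 < t) (hb : 0 < b) {x : V} (hx : x ≠ 0) :
    heatKernel t x ≤ (4 * Real.pi) ^ (-(Module.finrank ℝ V / 2 : ℝ)) * (4 * b) ^ b *
      t ^ (b - Module.finrank ℝ V / 2) * ‖x‖ ^ (-(2 * b)) := by
  have hx0 : 0 < ‖x‖ := norm_pos_iff.2 hx
  set y := ‖x‖ ^ 2 / (4 * t) with hy
  have gaussian_le : Real.exp (-y) ≤ (b / y) ^ b := by
    have hyb : (y / b) ^ b ≤ Real.exp y := by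
      calc (y / b) ^ b ≤ Real.exp (y / b) ^ b := by
            gcongr; linarith [Real.add_one_le_exp (y / b)]
        _ = Real.exp y := by rw [← Real.exp_mul, div_mul_cancel₀ _ hb.ne']
    rw [Real.exp_neg, ← inv_div, Real.inv_rpow (by positivity)]
    exact inv_anti₀ (by positivity) hyb
  calc heatKernel t x
      = (4 * Real.pi * t) ^ (-(Module.finrank ℝ V / 2 : ℝ)) * Real.exp (-y) := by
        rw [heatKernel, hy]; ring_nf
    _ ≤ (4 * Real.pi * t) ^ (-(Module.finrank ℝ V / 2 : ℝ)) * (b / y) ^ b := by gcongr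
    _ = _ := by
        have e : b / y = 4 * b * t / ‖x‖ ^ 2 := by rw [hy]; field_simp
        rw [e, Real.div_rpow (by positivity) (by positivity), Real.mul_rpow (by positivity) ht.le,
          Real.mul_rpow (by positivity) ht.le, ← Real.rpow_natCast, ← Real.rpow_mul hx0.le,
          sub_eq_add_neg, Real.rpow_add ht, Real.rpow_neg hx0.le]
        push_cast
        ring

/-- The kernel of `(1 - Δ)^(-s/2)`, as the superposition of heat kernels that corresponds to
`Γ(s/2) λ^(-s/2) = ∫ t^(s/2 - 1) exp(-λt) dt` with `λ = 1 - Δ`. -/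
noncomputable def besselKernel (s : ℝ) (x : V) : ℝ :=
  (Real.Gamma (s / 2))⁻¹ *
    ∫ t in Set.Ioi (0 : ℝ), Real.exp (-t) * t ^ (s / 2 - 1) * heatKernel t x

variable {s : ℝ}

theorem besselKernel_integrand_nonneg (x : V) :
    ∀ᵐ t ∂(volume : Measure ℝ).restrict (Set.Ioi 0),
      0 ≤ Real.exp (-t) * t ^ (s / 2 - 1) * heatKernel t x := by
  filter_upwards [ae_restrict_mem measurableSet_Ioi] with t (ht : 0 < t)
  have := heatKernel_nonneg ht x
  positivity

theorem besselKernel_nonneg (hs : 0 < s) (x : V) : 0 ≤ besselKernel s x :=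
  mul_nonneg (inv_nonneg.2 (Real.Gamma_pos_of_pos (half_pos hs)).le)
    (integral_nonneg_of_ae (besselKernel_integrand_nonneg x))

theorem measurable_besselKernel_integrand [MeasurableSpace V] [OpensMeasurableSpace V] :
    Measurable fun z : ℝ × V => Real.exp (-z.1) * z.1 ^ (s / 2 - 1) * heatKernel z.1 z.2 :=
  Measurable.mul (by fun_prop) measurable_heatKernel

theorem measurable_besselKernel [MeasurableSpace V] [OpensMeasurableSpace V] :
    Measurable (besselKernel s : V → ℝ) :=
  ((measurable_besselKernel_integrand.comp measurable_swap).stronglyMeasurable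
    |>.integral_prod_right').measurable.const_mul _

theorem exists_besselKernel_le_rpow {a : ℝ} (hs : 0 < s) (ha : 0 < a)
    (hsa : Module.finrank ℝ V - s < a) :
    ∃ C : ℝ, ∀ x : V, x ≠ 0 → besselKernel s x ≤ C * ‖x‖ ^ (-a) := by
  set c : ℝ := (4 * Real.pi) ^ (-(Module.finrank ℝ V / 2 : ℝ)) * (4 * (a / 2)) ^ (a / 2)
  have hexp : 0 < (s - Module.finrank ℝ V + a) / 2 := by linarith
  refine ⟨(Real.Gamma (s / 2))⁻¹ * (c * Real.Gamma ((s - Module.finrank ℝ V + a) / 2)),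
    fun x hx => ?_⟩
  have integrand_le : ∀ᵐ t ∂(volume : Measure ℝ).restrict (Set.Ioi 0),
      Real.exp (-t) * t ^ (s / 2 - 1) * heatKernel t x ≤ c * ‖x‖ ^ (-a) *
        (Real.exp (-t) * t ^ ((s - Module.finrank ℝ V + a) / 2 - 1)) := by
    filter_upwards [ae_restrict_mem measurableSet_Ioi] with t (ht : 0 < t)
    calc Real.exp (-t) * t ^ (s / 2 - 1) * heatKernel t x
        ≤ Real.exp (-t) * t ^ (s / 2 - 1) *
            (c * t ^ (a / 2 - Module.finrank ℝ V / 2) * ‖x‖ ^ (-(2 * (a / 2)))) := by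
          gcongr; exact heatKernel_le_rpow ht (half_pos ha) hx
      _ = _ := by
          rw [show (s - Module.finrank ℝ V + a) / 2 - 1 =
            (s / 2 - 1) + (a / 2 - Module.finrank ℝ V / 2) by ring, Real.rpow_add ht,
            mul_div_cancel₀ a two_ne_zero]
          ring
  rw [besselKernel, mul_assoc]
  refine mul_le_mul_of_nonneg_left ?_
    (inv_nonneg.2 (Real.Gamma_pos_of_pos (half_pos hs)).le)
  refine (integral_mono_of_nonneg (besselKernel_integrand_nonneg x)
    ((Real.GammaIntegral_convergent hexp).const_mul _) integrand_le).trans_eq ?_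
  rw [integral_const_mul, ← Real.Gamma_eq_integral hexp]
  ring

variable [FiniteDimensional ℝ V] [MeasurableSpace V] [BorelSpace V]

theorem integral_heatKernel {t : ℝ} (ht : 0 < t) : ∫ x : V, heatKernel t x = 1 := by
  unfold heatKernel
  rw [integral_const_mul, GaussianFourier.integral_rexp_neg_mul_sq_norm (by positivity),
    div_inv_eq_mul, mul_comm Real.pi, mul_right_comm, ← Real.rpow_add (by positivity),
    neg_add_cancel, Real.rpow_zero]

theorem integrable_heatKernel {t : ℝ} (ht : 0 < t) : Integrable (heatKernel t : V → ℝ) :=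
  integrable_of_integral_eq_one (integral_heatKernel ht)

theorem fourier_heatKernel {t : ℝ} (ht : 0 < t) (ξ : V) :
    𝓕 (fun x : V => (heatKernel t x : ℂ)) ξ =
      (Real.exp (-(4 * Real.pi ^ 2 * ‖ξ‖ ^ 2 * t)) : ℝ) := by
  set c : ℝ := (4 * Real.pi * t) ^ (-(Module.finrank ℝ V / 2 : ℝ)) with hc
  have hb : 0 < (((4 * t)⁻¹ : ℝ) : ℂ).re := by rw [Complex.ofReal_re]; positivity
  have normalization :
      (Real.pi / ((4 * t)⁻¹ : ℝ) : ℂ) ^ (Module.finrank ℝ V / 2 : ℂ) = (c⁻¹ : ℝ) := by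
    rw [hc, Real.rpow_neg (by positivity), inv_inv, Complex.ofReal_cpow (by positivity)]
    push_cast
    rw [div_inv_eq_mul]
    ring_nf
  have exponent : -(Real.pi : ℂ) ^ 2 * ‖ξ‖ ^ 2 / ((4 * t)⁻¹ : ℝ) =
      (-(4 * Real.pi ^ 2 * ‖ξ‖ ^ 2 * t) : ℝ) := by
    push_cast
    rw [div_inv_eq_mul]
    ring
  have scale : (fun x : V => (heatKernel t x : ℂ)) =
      (c : ℂ) • fun x : V => Complex.exp (-((4 * t)⁻¹ : ℝ) * ‖x‖ ^ 2) := by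
    ext x
    simp only [heatKernel, Pi.smul_apply, smul_eq_mul]
    push_cast
    rfl
  rw [scale]
  refine (congrFun (VectorFourier.fourierIntegral_const_smul _ _ _ _ _) ξ).trans ?_
  change (c : ℂ) • 𝓕 (fun x : V => Complex.exp (-((4 * t)⁻¹ : ℝ) * ‖x‖ ^ 2)) ξ = _
  rw [fourier_gaussian_innerProductSpace hb ξ, normalization, exponent, ← Complex.ofReal_exp,
    smul_eq_mul, ← mul_assoc, ← Complex.ofReal_mul, mul_inv_cancel₀ (by positivity),
    Complex.ofReal_one, one_mul]

theorem integrable_besselKernel_integrand (hs : 0 < s) :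
    Integrable (fun z : ℝ × V => Real.exp (-z.1) * z.1 ^ (s / 2 - 1) * heatKernel z.1 z.2)
      ((volume.restrict (Set.Ioi (0 : ℝ))).prod volume) := by
  refine (integrable_prod_iff measurable_besselKernel_integrand.aestronglyMeasurable).2 ⟨?_, ?_⟩
  · filter_upwards [ae_restrict_mem measurableSet_Ioi] with t ht
    exact (integrable_heatKernel ht).const_mul _
  · refine (Real.GammaIntegral_convergent (half_pos hs)).congr ?_
    filter_upwards [ae_restrict_mem measurableSet_Ioi] with t (ht : 0 < t)
    have norm_eq : ∀ x : V, ‖Real.exp (-t) * t ^ (s / 2 - 1) * heatKernel t x‖ =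
        Real.exp (-t) * t ^ (s / 2 - 1) * heatKernel t x := fun x => by
      have := heatKernel_nonneg ht x
      exact Real.norm_of_nonneg (by positivity)
    simp only [norm_eq]
    rw [integral_const_mul, integral_heatKernel ht, mul_one]

theorem integrable_besselKernel (hs : 0 < s) : Integrable (besselKernel s : V → ℝ) :=
  (integrable_besselKernel_integrand hs).integral_prod_right.const_mul _

theorem fourier_besselKernel_eq_integral_heatKernel (hs : 0 < s) (ξ : V) :
    𝓕 (fun x : V => (besselKernel s x : ℂ)) ξ = ((Real.Gamma (s / 2))⁻¹ : ℝ) *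
      ∫ t in Set.Ioi (0 : ℝ), ((Real.exp (-t) * t ^ (s / 2 - 1) : ℝ) : ℂ) *
        𝓕 (fun x : V => (heatKernel t x : ℂ)) ξ := by
  have hint : Integrable (Function.uncurry fun (x : V) (t : ℝ) => Real.fourierChar (-inner ℝ x ξ) •
      ((Real.exp (-t) * t ^ (s / 2 - 1) * heatKernel t x : ℝ) : ℂ))
      (volume.prod (volume.restrict (Set.Ioi (0 : ℝ)))) := by
    have h := (integrable_besselKernel_integrand (V := V) hs).swap.ofReal (𝕜 := ℂ)
    have char : Continuous fun z : V × ℝ => (Real.fourierChar (-inner ℝ z.1 ξ) : ℂ) := by fun_prop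
    refine h.mono (char.aestronglyMeasurable.smul h.aestronglyMeasurable) (.of_forall fun z => ?_)
    rw [Function.uncurry, Circle.norm_smul]
    rfl
  calc 𝓕 (fun x : V => (besselKernel s x : ℂ)) ξ
      = ((Real.Gamma (s / 2))⁻¹ : ℝ) * ∫ x : V, ∫ t in Set.Ioi (0 : ℝ),
          Real.fourierChar (-inner ℝ x ξ) •
            ((Real.exp (-t) * t ^ (s / 2 - 1) * heatKernel t x : ℝ) : ℂ) := by
        rw [Real.fourier_eq, ← integral_const_mul]
        congr 1; ext x
        simp only [Circle.smul_def]
        rw [integral_smul, integral_complex_ofReal, mul_smul_comm, besselKernel,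
          Complex.ofReal_mul]
    _ = ((Real.Gamma (s / 2))⁻¹ : ℝ) * ∫ t in Set.Ioi (0 : ℝ), ∫ x : V,
          Real.fourierChar (-inner ℝ x ξ) •
            ((Real.exp (-t) * t ^ (s / 2 - 1) * heatKernel t x : ℝ) : ℂ) := by
        rw [integral_integral_swap hint]
    _ = _ := by
        congr 2; ext t
        rw [Real.fourier_eq, ← integral_const_mul]
        congr 1; ext x
        rw [Complex.ofReal_mul, mul_smul_comm]

theorem fourier_besselKernel (hs : 0 < s) (ξ : V) :
    𝓕 (fun x : V => (besselKernel s x : ℂ)) ξ =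
      ((1 + 4 * Real.pi ^ 2 * ‖ξ‖ ^ 2) ^ (-s / 2) : ℝ) := by
  have gaussian : ∀ t ∈ Set.Ioi (0 : ℝ), ((Real.exp (-t) * t ^ (s / 2 - 1) : ℝ) : ℂ) *
      𝓕 (fun x : V => (heatKernel t x : ℂ)) ξ =
        ((t ^ (s / 2 - 1) * Real.exp (-((1 + 4 * Real.pi ^ 2 * ‖ξ‖ ^ 2) * t)) : ℝ) : ℂ) := by
    intro t ht
    rw [fourier_heatKernel ht, ← Complex.ofReal_mul, mul_right_comm, ← Real.exp_add]
    ring_nf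
  have hΓ : Real.Gamma (s / 2) ≠ 0 := (Real.Gamma_pos_of_pos (half_pos hs)).ne'
  rw [fourier_besselKernel_eq_integral_heatKernel hs, setIntegral_congr_fun measurableSet_Ioi
    gaussian, integral_complex_ofReal, Real.integral_rpow_mul_exp_neg_mul_Ioi (half_pos hs)
    (by positivity), ← Complex.ofReal_mul, mul_left_comm, inv_mul_cancel₀ hΓ, mul_one, one_div,
    Real.inv_rpow (by positivity), neg_div, Real.rpow_neg (by positivity)]

theorem memLp_besselKernel {m : ℝ} (hd : 0 < Module.finrank ℝ V) (hs : 0 < s) (hm : 1 ≤ m)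
    (h : 1 - 1 / m < s / Module.finrank ℝ V) : MemLp (besselKernel s : V → ℝ) (.ofReal m) := by
  have : Nontrivial V := Module.nontrivial_of_finrank_pos hd
  have hm0 : 0 < m := by linarith
  have hd' : (0 : ℝ) < Module.finrank ℝ V := by exact_mod_cast hd
  have hds : Module.finrank ℝ V - s < Module.finrank ℝ V / m := by
    rw [lt_div_iff₀ hd'] at h
    linear_combination h
  obtain ⟨a, hsa, ham⟩ :=
    exists_between (max_lt hds (show 0 < Module.finrank ℝ V / m by positivity))
  have decay {b : ℝ} (hb : 0 < b) (hsb : Module.finrank ℝ V - s < b) :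
      ∃ C : ℝ, ∀ᵐ x : V, ‖besselKernel s x‖ ≤ C * ‖x‖ ^ (-b) := by
    obtain ⟨C, hC⟩ := exists_besselKernel_le_rpow (V := V) hs hb hsb
    refine ⟨C, ?_⟩
    filter_upwards [Measure.ae_ne volume 0] with x hx
    rw [Real.norm_of_nonneg (besselKernel_nonneg hs x)]
    exact hC x hx
  obtain ⟨C, hC⟩ := decay ((le_max_right _ _).trans_lt hsa) ((le_max_left _ _).trans_lt hsa)
  obtain ⟨C', hC'⟩ := decay (b := Module.finrank ℝ V + 1) (by positivity) (by linarith)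
  exact memLp_of_norm_le_rpow hd measurable_besselKernel.aestronglyMeasurable hm0
    ((lt_div_iff₀ hm0).1 ham) (by nlinarith) hC hC'

end BesselKernel

section IsGivenBy

variable {d : ℕ} {S T : 𝓢'(Space d, ℂ)} {u v : Space d → ℂ}

theorem IsGivenBy.locallyIntegrable (h : IsGivenBy T u) : LocallyIntegrable u := by
  intro x
  let b : ContDiffBump x := ⟨1, 2, one_pos, one_lt_two⟩
  have hc : HasCompactSupport (Complex.ofRealCLM ∘ b) := b.hasCompactSupport.comp_left rfl
  have hs : ContDiff ℝ (⊤ : ℕ∞) (Complex.ofRealCLM ∘ b) :=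
    Complex.ofRealCLM.contDiff.comp b.contDiff
  refine ⟨Metric.closedBall x 1, Metric.closedBall_mem_nhds x one_pos,
    (h (hc.toSchwartzMap hs)).1.integrableOn.congr_fun (fun y hy => ?_)
      Metric.isClosed_closedBall.measurableSet⟩
  have : b y = 1 := b.one_of_mem_closedBall hy
  simp [this]

theorem IsGivenBy.ae_eq (hu : IsGivenBy T u) (hv : IsGivenBy T v) : u =ᵐ[volume] v := by
  refine ae_eq_of_integral_contDiff_smul_eq hu.locallyIntegrable hv.locallyIntegrable ?_
  intro g hg hgc
  have hc : HasCompactSupport (Complex.ofRealCLM ∘ g) := hgc.comp_left rfl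
  have hs : ContDiff ℝ (⊤ : ℕ∞) (Complex.ofRealCLM ∘ g) := Complex.ofRealCLM.contDiff.comp hg
  have h := (hu (hc.toSchwartzMap hs)).2.symm.trans (hv (hc.toSchwartzMap hs)).2
  simpa [Complex.real_smul] using h

theorem IsGivenBy.congr_ae (hu : IsGivenBy T u) (huv : u =ᵐ[volume] v) : IsGivenBy T v := by
  intro g
  have h : (fun x => g x * u x) =ᵐ[volume] fun x => g x * v x := by
    filter_upwards [huv] with x hx
    rw [hx]
  exact ⟨(hu g).1.congr h, (hu g).2.trans (integral_congr_ae h)⟩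

theorem IsGivenBy.unique (hS : IsGivenBy S u) (hT : IsGivenBy T u) : S = T := by
  ext g
  rw [(hS g).2, (hT g).2]

theorem IsGivenBy.add (hS : IsGivenBy S u) (hT : IsGivenBy T v) : IsGivenBy (S + T) (u + v) := by
  intro g
  have distrib : (fun x => g x * (u + v) x) = fun x => g x * u x + g x * v x := by
    ext x
    exact mul_add _ _ _
  rw [distrib, integral_add (hS g).1 (hT g).1, ← (hS g).2, ← (hT g).2]
  exact ⟨(hS g).1.add (hT g).1, rfl⟩

theorem isGivenBy_Lp {p : ℝ≥0∞} [hp : Fact (1 ≤ p)] (f : Lp ℂ p (volume : Measure (Space d))) :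
    IsGivenBy (Lp.toTemperedDistribution f) f := by
  intro g
  have : p.HolderConjugate (1 - p⁻¹)⁻¹ := ENNReal.HolderConjugate.inv_one_sub_inv' hp.out
  exact ⟨(g.memLp (1 - p⁻¹)⁻¹ volume).integrable_mul (Lp.memLp f), by simp⟩

theorem isGivenBy_toLp {p : ℝ≥0∞} [Fact (1 ≤ p)] (hu : MemLp u p) :
    IsGivenBy (Lp.toTemperedDistribution (hu.toLp u)) u :=
  (isGivenBy_Lp _).congr_ae hu.coeFn_toLp

end IsGivenBy

section Fourier

variable {V : Type*} [NormedAddCommGroup V] [InnerProductSpace ℝ V] [FiniteDimensional ℝ V]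
  [MeasurableSpace V] [BorelSpace V]

theorem integral_fourier_mul_eq_of_integrable {f g : V → ℂ} (hf : Integrable f)
    (hg : Integrable g) : ∫ ξ, 𝓕 f ξ * g ξ = ∫ x, f x * 𝓕 g x := by
  simpa using! VectorFourier.integral_fourierIntegral_smul_eq_flip (L := innerₗ V)
    Real.continuous_fourierChar continuous_inner hf hg

theorem fourier_smulLeftCLM_fourierInv {σ K : V → ℂ} (hσ : σ.HasTemperateGrowth)
    (hK : Integrable K) (hKσ : 𝓕 K = σ) (g : 𝓢(V, ℂ)) (x : V) :
    𝓕 (SchwartzMap.smulLeftCLM ℂ σ (𝓕⁻ g)) x = ∫ y, K (y - x) * g y := by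
  let G : V → ℂ := fun ξ => Real.fourierChar (-inner ℝ ξ x) • (𝓕⁻ g : 𝓢(V, ℂ)) ξ
  have hG : Integrable G := (Real.fourierIntegral_convergent_iff x).2 (𝓕⁻ g).integrable
  have fourier_G : ∀ y, 𝓕 G y = g (y + x) := fun y => by
    have inversion : g (y + x) = 𝓕 (𝓕⁻ g) (y + x) := by
      rw [FourierTransform.fourier_fourierInv_eq]
    rw [inversion, SchwartzMap.fourier_coe]
    simp only [G, Real.fourier_eq, smul_smul, ← AddChar.map_add_eq_mul, inner_add_right, neg_add]
  calc 𝓕 (SchwartzMap.smulLeftCLM ℂ σ (𝓕⁻ g)) x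
      = ∫ ξ, 𝓕 K ξ * G ξ := by
        rw [SchwartzMap.fourier_coe, Real.fourier_eq, hKσ]
        congr 1; ext ξ
        rw [SchwartzMap.smulLeftCLM_apply_apply hσ, smul_eq_mul, mul_smul_comm]
    _ = ∫ y, K y * g (y + x) := by
        rw [integral_fourier_mul_eq_of_integrable hK hG]
        simp only [fourier_G]
    _ = ∫ y, K (y - x) * g y := by
        rw [← integral_add_right_eq_self (fun y => K (y - x) * g y) x]
        simp only [add_sub_cancel_right]

end Fourier

section BesselPotential

open scoped Convolution

variable {d : ℕ}

theorem IsGivenBy.fourierMultiplierCLM_convolution {T : 𝓢'(Space d, ℂ)} {σ K f : Space d → ℂ}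
    (hT : IsGivenBy T f) (hσ : σ.HasTemperateGrowth) (hK : Integrable K) (hKσ : 𝓕 K = σ)
    (hint : ∀ g : 𝓢(Space d, ℂ),
      Integrable (fun z : Space d × Space d => g z.1 * (f z.2 * K (z.1 - z.2)))) :
    IsGivenBy (TemperedDistribution.fourierMultiplierCLM ℂ σ T)
      (f ⋆[ContinuousLinearMap.mul ℂ ℂ] K) := by
  intro g
  have pull_in : (fun x => g x * (f ⋆[ContinuousLinearMap.mul ℂ ℂ] K) x) =
      fun x => ∫ y, g x * (f y * K (x - y)) := by
    ext x
    rw [integral_const_mul]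
    rfl
  rw [pull_in]
  refine ⟨(hint g).integral_prod_left, ?_⟩
  rw [integral_integral_swap (hint g), TemperedDistribution.fourierMultiplierCLM_apply_apply,
    (hT _).2]
  congr 1; ext y
  rw [fourier_smulLeftCLM_fourierInv hσ hK hKσ, ← integral_mul_const]
  congr 1; ext x
  ring

theorem fourier_besselKernel_eq_besselSymbol {s : ℝ} (hs : 0 < s) :
    𝓕 (fun x : Space d => (besselKernel s x : ℂ)) = besselSymbol d (-s) := by
  ext ξ
  rw [fourier_besselKernel hs, besselSymbol, norm_smul, mul_pow, Real.norm_eq_abs, sq_abs]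
  ring_nf

theorem exists_bessel_isGivenBy (hd : 0 < d) {s q r : ℝ} (hs : 0 < s) (hq : 1 ≤ q)
    (hqr : q ≤ r) (h : 1 / q - 1 / r < s / d) :
    ∃ C : ℝ≥0, ∀ (T : 𝓢'(Space d, ℂ)) (f : Space d → ℂ), IsGivenBy T f →
      MemLp f (.ofReal q) → ∃ v, IsGivenBy (bessel d (-s) T) v ∧ MemLp v (.ofReal r) ∧
        eLpNorm v (.ofReal r) ≤ C * eLpNorm f (.ofReal q) := by
  have hq0 : 0 < q := by linarith
  have hr0 : 0 < r := by linarith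
  have one_div_le : 1 / r ≤ 1 / q := one_div_le_one_div_of_le hq0 hqr
  have one_div_q_le : 1 / q ≤ 1 := (div_le_one hq0).2 hq
  have one_div_r_pos : 0 < 1 / r := by positivity
  obtain ⟨m, hm1, hqm⟩ : ∃ m : ℝ, 1 ≤ m ∧ 1 / q + 1 / m = 1 + 1 / r :=
    ⟨1 / (1 - (1 / q - 1 / r)), by rw [le_div_iff₀ (by linarith)]; linarith,
      by rw [one_div_one_div]; ring⟩
  obtain ⟨K, hK_int, fourier_K, hK⟩ :
      ∃ K : Space d → ℂ, Integrable K ∧ 𝓕 K = besselSymbol d (-s) ∧ MemLp K (.ofReal m) := by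
    refine ⟨fun x => besselKernel s x, (integrable_besselKernel hs).ofReal,
      fourier_besselKernel_eq_besselSymbol hs,
      (memLp_besselKernel (by simpa using hd) hs hm1 ?_).ofReal⟩
    rw [finrank_euclideanSpace_fin]
    linarith
  obtain ⟨r', _⟩ : ∃ r', (ENNReal.ofReal r).HolderConjugate r' :=
    ⟨_, ENNReal.HolderConjugate.inv_one_sub_inv' (ENNReal.one_le_ofReal.2 (hq.trans hqr))⟩
  let L := ContinuousLinearMap.mul ℂ ℂ
  refine ⟨‖L‖₊ * (eLpNorm K (.ofReal m)).toNNReal, fun T f hT hf => ⟨f ⋆[L] K, ?_, ?_, ?_⟩⟩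
  · exact hT.fourierMultiplierCLM_convolution (besselSymbol_hasTemperateGrowth d (-s)) hK_int
      fourier_K fun g => integrable_mul_convolution_integrand hq hm1 hqm (g.memLp r' volume) hf hK
  · exact memLp_convolution L hq hm1 hr0 hqm hf hK
  · refine (eLpNorm_convolution_le L hq hm1 hr0 hqm hf.1 hK.1).trans_eq ?_
    rw [ENNReal.coe_mul, ENNReal.coe_toNNReal hK.2.ne, mul_comm (eLpNorm f _ _), ← mul_assoc]
    rfl

end BesselPotential

section Frequency

variable {d : ℕ} {S T : 𝓢'(Space d, ℂ)} {u v w W : Space d → ℂ}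

theorem eLpNorm_two_sq {α E : Type*} [MeasurableSpace α] [NormedAddCommGroup E] (μ : Measure α)
    (f : α → E) : eLpNorm f 2 μ ^ 2 = ∫⁻ x, ‖f x‖ₑ ^ 2 ∂μ := by
  simpa using eLpNorm_nnreal_pow_eq_lintegral (f := f) (μ := μ) (p := 2) two_ne_zero

theorem IsGivenBy.exists_fourier (hS : IsGivenBy S w) (hw : MemLp w 2) :
    ∃ v, IsGivenBy (𝓕 S) v ∧ MemLp v 2 ∧ eLpNorm v 2 = eLpNorm w 2 := by
  refine ⟨(𝓕 (hw.toLp w) : Lp ℂ 2 volume), ?_, Lp.memLp _, ?_⟩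
  · rw [hS.unique (isGivenBy_toLp hw), Lp.fourier_toTemperedDistribution_eq]
    exact isGivenBy_Lp _
  · rw [← Lp.enorm_def, ← ofReal_norm, Lp.norm_fourier_eq, ofReal_norm, Lp.enorm_toLp]

theorem IsGivenBy.exists_fourierInv (hS : IsGivenBy S w) (hw : MemLp w 2) :
    ∃ v, IsGivenBy (𝓕⁻ S) v ∧ MemLp v 2 ∧ eLpNorm v 2 = eLpNorm w 2 := by
  refine ⟨(𝓕⁻ (hw.toLp w) : Lp ℂ 2 volume), ?_, Lp.memLp _, ?_⟩
  · rw [hS.unique (isGivenBy_toLp hw), Lp.fourierInv_toTemperedDistribution_eq]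
    exact isGivenBy_Lp _
  · rw [← Lp.enorm_def, ← ofReal_norm, ← Lp.norm_fourier_eq, FourierTransform.fourier_fourierInv_eq,
      ofReal_norm, Lp.enorm_toLp]

theorem IsGivenBy.fourierInv_of_integrable (hS : IsGivenBy S w) (hw : Integrable w) :
    IsGivenBy (𝓕⁻ S) (𝓕⁻ w) := by
  have hw_neg : Integrable fun ξ => w (-ξ) := hw.comp_neg
  have h_cont : Continuous (𝓕⁻ w) := by
    rw [Real.fourierInv_eq_fourier_comp_neg]
    exact VectorFourier.fourierIntegral_continuous (L := innerₗ (Space d))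
      Real.continuous_fourierChar continuous_inner hw_neg
  have h_bound : ∀ x, ‖𝓕⁻ w x‖ ≤ ∫ ξ, ‖w (-ξ)‖ := fun x => by
    rw [Real.fourierInv_eq_fourier_comp_neg]
    exact VectorFourier.norm_fourierIntegral_le_integral_norm _ _ _ _ _
  intro g
  refine ⟨g.integrable.mul_bdd h_cont.aestronglyMeasurable (.of_forall h_bound), ?_⟩
  calc (𝓕⁻ S) g = ∫ ξ, 𝓕⁻ (g : Space d → ℂ) ξ * w ξ := by
        rw [TemperedDistribution.fourierInv_apply, (hS _).2, SchwartzMap.fourierInv_coe]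
    _ = ∫ ξ, 𝓕 (g : Space d → ℂ) ξ * w (-ξ) := by
        rw [← integral_neg_eq_self]
        simp only [Real.fourierInv_eq_fourier_neg, neg_neg]
    _ = ∫ x, g x * 𝓕⁻ w x := by
        rw [integral_fourier_mul_eq_of_integrable g.integrable hw_neg,
          Real.fourierInv_eq_fourier_comp_neg]

theorem enorm_fourierInv_le (w : Space d → ℂ) (x : Space d) : ‖𝓕⁻ w x‖ₑ ≤ ∫⁻ ξ, ‖w ξ‖ₑ := by
  rw [Real.fourierInv_eq]
  refine (enorm_integral_le_lintegral_enorm _).trans_eq (lintegral_congr fun ξ => ?_)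
  rw [← ofReal_norm, Circle.norm_smul, ofReal_norm]

theorem IsGivenBy.exists_frequency_split (hT : IsGivenBy (𝓕 T) W) {A : Set (Space d)}
    (hA : MeasurableSet A) (hW : IntegrableOn W A) (hW' : MemLp (Aᶜ.indicator W) 2) :
    ∃ a b : Space d → ℂ, IsGivenBy T (a + b) ∧ (∀ x, ‖a x‖ₑ ≤ ∫⁻ ξ in A, ‖W ξ‖ₑ) ∧
      MemLp b 2 ∧ eLpNorm b 2 = eLpNorm (Aᶜ.indicator W) 2 := by
  have h_low : Integrable (A.indicator W) := (integrable_indicator_iff hA).2 hW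
  have given_low := isGivenBy_toLp (memLp_one_iff_integrable.2 h_low)
  have given_high := isGivenBy_toLp hW'
  obtain ⟨b, given_b, hb, norm_b⟩ := given_high.exists_fourierInv hW'
  refine ⟨𝓕⁻ (A.indicator W), b, ?_, fun x => ?_, hb, norm_b⟩
  · have split := given_low.add given_high
    rw [Set.indicator_self_add_compl] at split
    rw [← FourierTransform.fourierInv_fourier_eq (F := 𝓢'(Space d, ℂ)) T, hT.unique split,
      FourierTransform.fourierInv_add]
    exact (given_low.fourierInv_of_integrable h_low).add given_b
  · refine (enorm_fourierInv_le _ x).trans_eq ?_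
    simp only [enorm_indicator_eq_indicator_enorm, lintegral_indicator hA]

theorem meas_lt_norm_le_setLIntegral_compl (hu : IsGivenBy T u) (hT : IsGivenBy (𝓕 T) W)
    {A : Set (Space d)} (hA : MeasurableSet A) (hW : AEStronglyMeasurable W)
    (hW' : MemLp (Aᶜ.indicator W) 2) {t : ℝ} (ht : 0 < t)
    (h_low : ∫⁻ ξ in A, ‖W ξ‖ₑ ≤ .ofReal (t / 2)) :
    volume {x | t < ‖u x‖} ≤ .ofReal (4 / t ^ 2) * ∫⁻ ξ in Aᶜ, ‖W ξ‖ₑ ^ 2 := by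
  obtain ⟨a, b, hab, ha, hb, norm_b⟩ := hT.exists_frequency_split hA
    ⟨hW.restrict, h_low.trans_lt ENNReal.ofReal_lt_top⟩ hW'
  have large_high : {x | t < ‖u x‖} ≤ᵐ[volume] {x | .ofReal (t / 2) ≤ ‖b x‖ₑ} := by
    filter_upwards [hu.ae_eq hab] with x hx (hxt : t < ‖u x‖)
    have ha_le : ‖a x‖ ≤ t / 2 := by
      rw [← ENNReal.ofReal_le_ofReal_iff (by positivity), ofReal_norm]
      exact (ha x).trans h_low
    have u_le : ‖u x‖ ≤ ‖a x‖ + ‖b x‖ := hx ▸ norm_add_le _ _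
    change ENNReal.ofReal (t / 2) ≤ ‖b x‖ₑ
    rw [← ofReal_norm]
    exact ENNReal.ofReal_le_ofReal (by linarith)
  calc volume {x | t < ‖u x‖}
      ≤ (ENNReal.ofReal (t / 2))⁻¹ ^ 2 * eLpNorm b 2 ^ 2 := by
        refine (measure_mono_ae large_high).trans ?_
        simpa using meas_ge_le_mul_pow_eLpNorm_enorm volume two_ne_zero ENNReal.ofNat_ne_top hb.1
          (ε := .ofReal (t / 2)) (by simpa using ht) (by simp)
    _ = .ofReal (4 / t ^ 2) * ∫⁻ ξ in Aᶜ, ‖W ξ‖ₑ ^ 2 := by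
        rw [norm_b, eLpNorm_two_sq, ← ENNReal.ofReal_inv_of_pos (by positivity),
          ← ENNReal.ofReal_pow (by positivity), ← lintegral_indicator hA.compl]
        congr 1
        · congr 1; field_simp; norm_num
        · refine lintegral_congr fun ξ => ?_
          by_cases h : ξ ∈ Aᶜ <;> simp [h]

theorem bessel_neg_bessel (s : ℝ) (T : 𝓢'(Space d, ℂ)) : bessel d (-s) (bessel d s T) = T := by
  unfold bessel
  rw [TemperedDistribution.fourierMultiplierCLM_fourierMultiplierCLM_apply
    (besselSymbol_hasTemperateGrowth d s) (besselSymbol_hasTemperateGrowth d (-s))]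
  have symbol_mul : besselSymbol d s * besselSymbol d (-s) = fun _ => (1 : ℂ) := by
    ext ξ
    rw [Pi.mul_apply, besselSymbol, besselSymbol, ← Complex.ofReal_mul,
      ← Real.rpow_add (by positivity), neg_div, add_neg_cancel, Real.rpow_zero, Complex.ofReal_one]
  rw [symbol_mul, TemperedDistribution.fourierMultiplierCLM_const, one_smul,
    ContinuousLinearMap.id_apply]

theorem IsGivenBy.smulLeftCLM {σ : Space d → ℂ} (hσ : σ.HasTemperateGrowth)
    (hS : IsGivenBy S w) :
    IsGivenBy (TemperedDistribution.smulLeftCLM ℂ σ S) fun ξ => σ ξ * w ξ := by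
  intro g
  have move_symbol : ∀ ξ, SchwartzMap.smulLeftCLM ℂ σ g ξ * w ξ = g ξ * (σ ξ * w ξ) := fun ξ => by
    rw [SchwartzMap.smulLeftCLM_apply_apply hσ, smul_eq_mul]
    ring
  simpa only [move_symbol, TemperedDistribution.smulLeftCLM_apply_apply] using
    hS (SchwartzMap.smulLeftCLM ℂ σ g)

theorem IsBesselOf.exists_fourier {s : ℝ} (h : IsBesselOf s u v) (hv : MemLp v 2) :
    ∃ (T : 𝓢'(Space d, ℂ)) (V : Space d → ℂ), IsGivenBy T u ∧
      IsGivenBy (𝓕 T) (fun ξ => besselSymbol d (-s) ξ * V ξ) ∧ MemLp V 2 ∧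
      eLpNorm V 2 = eLpNorm v 2 := by
  obtain ⟨T, hu, hT⟩ := h
  obtain ⟨V, given_V, hV, norm_V⟩ := hT.exists_fourier hv
  refine ⟨T, V, hu, ?_, hV, norm_V⟩
  rw [← bessel_neg_bessel s T, bessel, TemperedDistribution.fourierMultiplierCLM_apply,
    FourierTransform.fourier_fourierInv_eq]
  exact given_V.smulLeftCLM (besselSymbol_hasTemperateGrowth d (-s))

theorem norm_rpow_mul_norm_besselSymbol_neg_le {a s : ℝ} (ha : 0 ≤ a) (has : a ≤ s)
    (ξ : Space d) : ‖ξ‖ ^ a * ‖besselSymbol d (-s) ξ‖ ≤ 1 := by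
  have one_le : 1 ≤ 1 + ‖(2 * Real.pi) • ξ‖ ^ 2 := by simp
  have sq_le : ‖ξ‖ ^ 2 ≤ 1 + ‖(2 * Real.pi) • ξ‖ ^ 2 := by
    rw [norm_smul, mul_pow, Real.norm_of_nonneg (by positivity)]
    have : 1 ≤ (2 * Real.pi) ^ 2 := one_le_pow₀ (by linarith [Real.pi_gt_three])
    nlinarith [sq_nonneg ‖ξ‖]
  calc ‖ξ‖ ^ a * ‖besselSymbol d (-s) ξ‖
      = (‖ξ‖ ^ 2) ^ (a / 2) * (1 + ‖(2 * Real.pi) • ξ‖ ^ 2) ^ (-s / 2) := by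
        rw [besselSymbol, Complex.norm_real, Real.norm_of_nonneg (by positivity),
          ← Real.rpow_natCast_mul (norm_nonneg ξ)]
        ring_nf
    _ ≤ (1 + ‖(2 * Real.pi) • ξ‖ ^ 2) ^ (s / 2) * (1 + ‖(2 * Real.pi) • ξ‖ ^ 2) ^ (-s / 2) := by
        gcongr ?_ * _
        exact (Real.rpow_le_rpow (by positivity) sq_le (by linarith)).trans
          (Real.rpow_le_rpow_of_exponent_le one_le (by linarith))
    _ = 1 := by rw [← Real.rpow_add (by positivity), neg_div, add_neg_cancel, Real.rpow_zero]

end Frequency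

section LowFrequency

variable {V : Type*} [NormedAddCommGroup V] [NormedSpace ℝ V] [FiniteDimensional ℝ V]
  [MeasurableSpace V] [BorelSpace V] {μ : Measure V} [μ.IsAddHaarMeasure]

theorem setIntegral_ball_norm_rpow (a : ℝ) {R : ℝ} (hR : 0 < R) :
    ∫ x in Metric.ball (0 : V) R, ‖x‖ ^ a ∂μ =
      R ^ (Module.finrank ℝ V + a) * ∫ x in Metric.ball (0 : V) 1, ‖x‖ ^ a ∂μ := by
  have dilate := Measure.setIntegral_comp_smul_of_pos μ (fun x : V => ‖x‖ ^ a)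
    (Metric.ball 0 1) hR
  simp only [smul_unitBall_of_pos hR, norm_smul, Real.norm_of_nonneg hR.le,
    Real.mul_rpow hR.le (norm_nonneg _), integral_const_mul, smul_eq_mul] at dilate
  rw [Real.rpow_add hR, Real.rpow_natCast, mul_assoc, dilate, mul_inv_cancel_left₀ (by positivity)]

theorem exists_setLIntegral_ball_enorm_le {E : Type*} [NormedAddCommGroup E] [NormedSpace ℝ E]
    {s : ℝ} (hd : 1 ≤ Module.finrank ℝ V) (hs : 2 * s < Module.finrank ℝ V) :
    ∃ K > 0, ∀ W : V → E, AEStronglyMeasurable W μ → ∀ R > 0,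
      ∫⁻ ξ in Metric.ball 0 R, ‖W ξ‖ₑ ∂μ ≤
        .ofReal (K * R ^ (Module.finrank ℝ V / 2 - s)) * eLpNorm (fun ξ => ‖ξ‖ ^ s • W ξ) 2 μ := by
  have : Nontrivial V := Module.nontrivial_of_finrank_pos (R := ℝ) hd
  let κ := ∫ x in Metric.ball (0 : V) 1, ‖x‖ ^ (-(2 * s)) ∂μ
  refine ⟨√κ + 1, by positivity, fun W hW R hR => ?_⟩
  have integrable_weight : IntegrableOn (fun x : V => ‖x‖ ^ (-(2 * s))) (Metric.ball 0 R) μ :=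
    integrableOn_ball_of_norm_le_rpow hd hs (C := 1)
      (.of_forall fun x => by rw [Real.norm_of_nonneg (by positivity), one_mul])
      (measurable_norm.pow_const _).aestronglyMeasurable
  have weight_norm : (∫⁻ ξ in Metric.ball (0 : V) R, ENNReal.ofReal (‖ξ‖ ^ (-s)) ^ (2 : ℝ) ∂μ) ^
      (1 / 2 : ℝ) = .ofReal (√κ * R ^ (Module.finrank ℝ V / 2 - s)) := by
    have sq_weight : ∀ ξ : V, ENNReal.ofReal (‖ξ‖ ^ (-s)) ^ (2 : ℝ) =
        .ofReal (‖ξ‖ ^ (-(2 * s))) := fun ξ => by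
      rw [ENNReal.ofReal_rpow_of_nonneg (by positivity) two_pos.le, ← Real.rpow_mul (norm_nonneg ξ)]
      ring_nf
    simp only [sq_weight]
    rw [← ofReal_integral_eq_lintegral_ofReal integrable_weight (.of_forall fun x => by positivity),
      setIntegral_ball_norm_rpow _ hR, ENNReal.ofReal_rpow_of_nonneg (by positivity) (by norm_num),
      Real.mul_rpow (by positivity) (by positivity), ← Real.sqrt_eq_rpow κ, ← Real.rpow_mul hR.le,
      mul_comm]
    ring_nf
  calc ∫⁻ ξ in Metric.ball 0 R, ‖W ξ‖ₑ ∂μ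
      = ∫⁻ ξ in Metric.ball 0 R, ENNReal.ofReal (‖ξ‖ ^ (-s)) * ‖‖ξ‖ ^ s • W ξ‖ₑ ∂μ := by
        refine lintegral_congr_ae (ae_restrict_of_ae ?_)
        filter_upwards [Measure.ae_ne μ 0] with ξ hξ
        rw [enorm_smul, ← mul_assoc, ← ofReal_norm (‖ξ‖ ^ s), Real.norm_of_nonneg (by positivity),
          ← ENNReal.ofReal_mul (by positivity), ← Real.rpow_add (norm_pos_iff.2 hξ), neg_add_cancel,
          Real.rpow_zero, ENNReal.ofReal_one, one_mul]
    _ ≤ .ofReal (√κ * R ^ (Module.finrank ℝ V / 2 - s)) *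
        eLpNorm (fun ξ => ‖ξ‖ ^ s • W ξ) 2 (μ.restrict (Metric.ball 0 R)) := by
        rw [← weight_norm, eLpNorm_eq_lintegral_rpow_enorm_toReal two_ne_zero ENNReal.ofNat_ne_top]
        refine ENNReal.lintegral_mul_le_Lp_mul_Lq _ Real.HolderConjugate.two_two (by fun_prop) ?_
        exact ((measurable_norm.pow_const s).aestronglyMeasurable.smul hW.restrict).enorm
    _ ≤ _ := by
        gcongr
        · linarith
        · exact Measure.restrict_le_self

end LowFrequency

theorem lintegral_rpow_le_of_meas_lt_le {α β : Type*} [MeasurableSpace α] [MeasurableSpace β]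
    {μ : Measure α} {ν : Measure β} {f : α → ℝ} {ρ : β → ℝ} {c p q : ℝ} (hf : AEMeasurable f μ)
    (hf0 : 0 ≤ f) (hρ : AEMeasurable ρ ν) (hρ0 : 0 ≤ ρ) (hp : 0 < p) (hq : q < p)
    (h : ∀ t > 0, μ {x | t < f x} ≤ .ofReal (c * t ^ (-q)) * ν {y | t ≤ ρ y}) :
    ∫⁻ x, .ofReal (f x ^ p) ∂μ ≤
      .ofReal (c * (p / (p - q))) * ∫⁻ y, .ofReal (ρ y ^ (p - q)) ∂ν := by
  have hpq : 0 < p - q := sub_pos.2 hq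
  rw [lintegral_rpow_eq_lintegral_meas_lt_mul μ (.of_forall hf0) hf hp,
    lintegral_rpow_eq_lintegral_meas_le_mul ν (.of_forall hρ0) hρ hpq, ← mul_assoc,
    ← ENNReal.ofReal_mul' hpq.le, mul_assoc c, div_mul_cancel₀ _ hpq.ne', mul_comm c,
    ENNReal.ofReal_mul hp.le, mul_assoc, ← lintegral_const_mul' (.ofReal c) _ ENNReal.ofReal_ne_top]
  refine mul_le_mul_right (setLIntegral_mono' measurableSet_Ioi fun t (ht : 0 < t) => ?_) _
  calc μ {x | t < f x} * .ofReal (t ^ (p - 1))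
      ≤ .ofReal (c * t ^ (-q)) * ν {y | t ≤ ρ y} * .ofReal (t ^ (p - 1)) := by grw [h t ht]
    _ = .ofReal c * (ν {y | t ≤ ρ y} * .ofReal (t ^ (p - q - 1))) := by
        rw [mul_right_comm, ← ENNReal.ofReal_mul' (by positivity), mul_assoc c, ← Real.rpow_add ht,
          ENNReal.ofReal_mul' (by positivity), mul_assoc, mul_comm (ν _)]
        ring_nf

section Sobolev

variable {d : ℕ} {s : ℝ}

theorem exists_meas_lt_norm_le_withDensity (hd : 0 < d) (hs : 0 ≤ s) (hsd : s < d / 2) :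
    ∃ B > 0, ∀ (T : 𝓢'(Space d, ℂ)) (u W : Space d → ℂ), IsGivenBy T u → IsGivenBy (𝓕 T) W →
      ∀ M > 0, eLpNorm (fun ξ => ‖ξ‖ ^ s • W ξ) 2 ≤ .ofReal M → ∀ t > 0,
        volume {x | t < ‖u x‖} ≤ .ofReal (4 * t ^ (-2 : ℝ)) *
          volume.withDensity (fun ξ => ‖W ξ‖ₑ ^ 2) {ξ | t ≤ B * M * ‖ξ‖ ^ (d / 2 - s)} := by
  obtain ⟨K, hK, low⟩ := exists_setLIntegral_ball_enorm_le (V := Space d) (E := ℂ) (μ := volume)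
    (s := s) (by rwa [finrank_euclideanSpace_fin]) (by rw [finrank_euclideanSpace_fin]; linarith)
  rw [finrank_euclideanSpace_fin] at low
  refine ⟨2 * K, by positivity, fun T u W hu hW M hM hWM t ht => ?_⟩
  have ha : 0 < d / 2 - s := sub_pos.2 hsd
  -- At this radius the low frequencies contribute `K R^(d/2 - s) M = t / 2`.
  let R := (t / (2 * K * M)) ^ (d / 2 - s)⁻¹
  have hR : 0 < R := by positivity
  have compl_ball : {ξ : Space d | t ≤ 2 * K * M * ‖ξ‖ ^ (d / 2 - s)} = (Metric.ball 0 R)ᶜ := by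
    ext ξ
    simp only [Set.mem_ofPred_eq, Set.mem_compl_iff, mem_ball_zero_iff, not_lt, R]
    rw [Real.rpow_inv_le_iff_of_pos (by positivity) (norm_nonneg ξ) ha,
      div_le_iff₀' (by positivity)]
  have hW_meas := hW.locallyIntegrable.aestronglyMeasurable
  have memLp_weighted : MemLp (fun ξ => ‖ξ‖ ^ s • W ξ) 2 :=
    ⟨(measurable_norm.pow_const s).aestronglyMeasurable.smul hW_meas,
      hWM.trans_lt ENNReal.ofReal_lt_top⟩
  have memLp_high : MemLp ((Metric.ball 0 R)ᶜ.indicator W) 2 := by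
    refine memLp_weighted.of_le_mul (c := R ^ (-s))
      (hW_meas.indicator measurableSet_ball.compl) (.of_forall fun ξ => ?_)
    by_cases hξ : ξ ∈ (Metric.ball 0 R)ᶜ
    · have R_le : R ≤ ‖ξ‖ := by simpa using hξ
      rw [Set.indicator_of_mem hξ, norm_smul, Real.norm_of_nonneg (by positivity), ← mul_assoc]
      refine le_mul_of_one_le_left (norm_nonneg _) ?_
      rw [Real.rpow_neg hR.le, inv_mul_eq_div, one_le_div (by positivity)]
      exact Real.rpow_le_rpow hR.le R_le hs
    · rw [Set.indicator_of_notMem hξ, norm_zero]; positivity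
  rw [compl_ball, withDensity_apply _ measurableSet_ball.compl, Real.rpow_neg ht.le,
    ← div_eq_mul_inv, Real.rpow_two]
  refine meas_lt_norm_le_setLIntegral_compl hu hW measurableSet_ball hW_meas memLp_high ht ?_
  refine (low W hW_meas R hR).trans ((mul_le_mul_right hWM _).trans_eq ?_)
  rw [← ENNReal.ofReal_mul (by positivity), Real.rpow_inv_rpow (by positivity) ha.ne']
  congr 1
  field_simp

theorem exists_lintegral_norm_rpow_le (hs : 0 < s) (hsd : s < d / 2) :
    ∃ c > 0, ∀ (T : 𝓢'(Space d, ℂ)) (u W : Space d → ℂ), IsGivenBy T u → IsGivenBy (𝓕 T) W →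
      ∀ M > 0, eLpNorm (fun ξ => ‖ξ‖ ^ s • W ξ) 2 ≤ .ofReal M →
        ∫⁻ x, .ofReal (‖u x‖ ^ (d / (d / 2 - s))) ≤ .ofReal (c * M ^ (d / (d / 2 - s))) := by
  have hd : (0 : ℝ) < d := by linarith
  obtain ⟨B, hB, meas_le⟩ := exists_meas_lt_norm_le_withDensity (by exact_mod_cast hd) hs.le hsd
  set a := d / 2 - s with ha_def
  have ha : 0 < a := sub_pos.2 hsd
  have a_mul : a * (d / a - 2) = 2 * s := by field_simp; rw [ha_def]; ring
  have two_lt : 2 < d / a := sub_pos.1 (pos_of_mul_pos_right (a_mul ▸ by positivity) ha.le)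
  have : 0 < d / a - 2 := sub_pos.2 two_lt
  refine ⟨4 * (d / a / (d / a - 2)) * B ^ (d / a - 2), by positivity,
    fun T u W hu hW M hM hWM => ?_⟩
  have hW_meas := hW.locallyIntegrable.aestronglyMeasurable
  have weight_eq : ∀ ξ, ‖W ξ‖ₑ ^ 2 * ENNReal.ofReal ((B * M * ‖ξ‖ ^ a) ^ (d / a - 2)) =
      .ofReal ((B * M) ^ (d / a - 2)) * ‖‖ξ‖ ^ s • W ξ‖ₑ ^ 2 := fun ξ => by
    rw [Real.mul_rpow (by positivity) (by positivity), ← Real.rpow_mul (norm_nonneg ξ), a_mul,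
      mul_comm 2 s, Real.rpow_mul (norm_nonneg ξ), Real.rpow_two,
      ENNReal.ofReal_mul (by positivity), ENNReal.ofReal_pow (by positivity), enorm_smul, mul_pow,
      ← ofReal_norm (‖ξ‖ ^ s), Real.norm_of_nonneg (by positivity)]
    ring
  calc ∫⁻ x, .ofReal (‖u x‖ ^ (d / a))
      ≤ .ofReal (4 * (d / a / (d / a - 2))) * ∫⁻ ξ, .ofReal ((B * M * ‖ξ‖ ^ a) ^ (d / a - 2))
          ∂volume.withDensity fun ξ => ‖W ξ‖ₑ ^ 2 :=
        lintegral_rpow_le_of_meas_lt_le hu.locallyIntegrable.aestronglyMeasurable.norm.aemeasurable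
          (fun x => norm_nonneg _) (by fun_prop) (fun ξ => by positivity) (by positivity) two_lt
          (meas_le T u W hu hW M hM hWM)
    _ = .ofReal (4 * (d / a / (d / a - 2)) * (B * M) ^ (d / a - 2)) *
          eLpNorm (fun ξ => ‖ξ‖ ^ s • W ξ) 2 ^ 2 := by
        rw [lintegral_withDensity_eq_lintegral_mul₀ (hW_meas.enorm.pow_const 2) (by fun_prop)]
        simp only [Pi.mul_apply, weight_eq]
        rw [lintegral_const_mul' _ _ ENNReal.ofReal_ne_top, eLpNorm_two_sq, ← mul_assoc,
          ← ENNReal.ofReal_mul (by positivity)]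
    _ ≤ .ofReal (4 * (d / a / (d / a - 2)) * (B * M) ^ (d / a - 2)) * .ofReal M ^ 2 := by gcongr
    _ = .ofReal (4 * (d / a / (d / a - 2)) * B ^ (d / a - 2) * M ^ (d / a)) := by
        rw [← ENNReal.ofReal_pow hM.le, ← ENNReal.ofReal_mul (by positivity),
          Real.mul_rpow hB.le hM.le, ← Real.rpow_two M, mul_assoc, mul_assoc (B ^ _),
          ← Real.rpow_add hM, sub_add_cancel, ← mul_assoc]

theorem exists_eLpNorm_le_eLpNorm_rpow_smul (hs : 0 < s) (hsd : s < d / 2) :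
    ∃ C : ℝ≥0, ∀ (T : 𝓢'(Space d, ℂ)) (u W : Space d → ℂ), IsGivenBy T u → IsGivenBy (𝓕 T) W →
      eLpNorm u (.ofReal (d / (d / 2 - s))) ≤ C * eLpNorm (fun ξ => ‖ξ‖ ^ s • W ξ) 2 := by
  obtain ⟨c, hc, lintegral_le⟩ := exists_lintegral_norm_rpow_le hs hsd
  have hp : 0 < d / (d / 2 - s) := div_pos (by linarith) (by linarith)
  generalize d / (d / 2 - s) = p at hp lintegral_le ⊢
  refine ⟨(c ^ (1 / p)).toNNReal, fun T u W hu hW => ?_⟩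
  refine ENNReal.le_mul_of_forall_lt (.inl (ENNReal.ofReal_pos.2 (Real.rpow_pos_of_pos hc _)).ne')
    (.inl ENNReal.coe_ne_top) fun C hC N hN => ?_
  rcases eq_or_ne N ∞ with rfl | hN'
  · simp [(pos_of_gt hC).ne']
  have norm_le : eLpNorm (fun ξ => ‖ξ‖ ^ s • W ξ) 2 ≤ .ofReal N.toReal := by
    rw [ENNReal.ofReal_toReal hN']; exact hN.le
  have hM : 0 < N.toReal := ENNReal.toReal_pos (pos_of_gt hN).ne' hN'
  have norm_u : eLpNorm u (.ofReal p) = (∫⁻ x, .ofReal (‖u x‖ ^ p)) ^ (1 / p) := by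
    rw [eLpNorm_eq_lintegral_rpow_enorm_toReal (by simpa using hp) ENNReal.ofReal_ne_top,
      ENNReal.toReal_ofReal hp.le]
    simp only [← ofReal_norm, ENNReal.ofReal_rpow_of_nonneg (norm_nonneg _) hp.le]
  rw [norm_u]
  refine (ENNReal.rpow_le_rpow (lintegral_le T u W hu hW _ hM norm_le) (by positivity)).trans ?_
  rw [ENNReal.ofReal_rpow_of_nonneg (by positivity) (by positivity),
    Real.mul_rpow hc.le (by positivity), ← Real.rpow_mul hM.le, mul_one_div_cancel hp.ne',
    Real.rpow_one, ENNReal.ofReal_mul (by positivity), ENNReal.ofReal_toReal hN']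
  exact mul_le_mul_left hC.le N

end Sobolev

section Cubic

variable {d : ℕ} {s p : ℝ}

theorem exists_eLpNorm_le_of_isBesselOf (hd : 0 < d) (hp : 2 < p) (h : 1 / 2 - 1 / p ≤ s / d) :
    ∃ C : ℝ≥0, ∀ u v : Space d → ℂ, IsBesselOf s u v → MemLp v 2 →
      eLpNorm u (.ofReal p) ≤ C * eLpNorm v 2 := by
  have hd0 : (0 : ℝ) < d := by exact_mod_cast hd
  have hp0 : 0 < p := by linarith
  let a := d * (1 / 2 - 1 / p)
  have ha : 0 < a := mul_pos hd0 (sub_pos.2 (one_div_lt_one_div_of_lt two_pos hp))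
  have gap : d / 2 - a = d / p := by ring
  have had : a < d / 2 := sub_pos.1 (gap ▸ div_pos hd0 hp0)
  have has : a ≤ s := by rwa [le_div_iff₀' hd0] at h
  obtain ⟨C, sobolev⟩ := exists_eLpNorm_le_eLpNorm_rpow_smul ha had
  rw [gap, div_div_cancel₀ hd0.ne'] at sobolev
  refine ⟨C, fun u v huv hv => ?_⟩
  obtain ⟨T, V, hu, hT, -, norm_V⟩ := huv.exists_fourier hv
  rw [← norm_V]
  refine (sobolev T u _ hu hT).trans (mul_right_mono (eLpNorm_mono fun ξ => ?_))
  rw [norm_smul, norm_mul, Real.norm_of_nonneg (by positivity), ← mul_assoc]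
  exact mul_le_of_le_one_left (norm_nonneg _) (norm_rpow_mul_norm_besselSymbol_neg_le ha.le has ξ)

theorem IsBesselOf.locallyIntegrable {u v : Space d → ℂ} (h : IsBesselOf s u v) :
    LocallyIntegrable u :=
  h.choose_spec.1.locallyIntegrable

theorem IsBesselOf.ae_eq {u v w : Space d → ℂ} (hv : IsBesselOf s u v) (hw : IsBesselOf s u w) :
    v =ᵐ[volume] w := by
  obtain ⟨S, hS, hSv⟩ := hv
  obtain ⟨T, hT, hTw⟩ := hw
  obtain rfl := hS.unique hT
  exact hSv.ae_eq hTw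

theorem IsBesselOf.normW_eq {p : ℝ≥0∞} {u v : Space d → ℂ} (h : IsBesselOf s u v)
    (hv : MemLp v p) : normW s p u = eLpNorm v p :=
  le_antisymm (iInf₂_le v ⟨hv, h⟩) (le_iInf₂ fun _ hw => (eLpNorm_congr_ae (h.ae_eq hw.2)).le)

theorem norm_cubic (φ : Space d → ℂ) (x : Space d) : ‖cubic φ x‖ = ‖φ x‖ ^ 3 := by
  rw [cubic, norm_mul, Complex.norm_real, norm_pow, norm_norm, ← pow_succ]

theorem eLpNorm_cubic (φ : Space d → ℂ) {q : ℝ} (hq : 0 ≤ q) :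
    eLpNorm (cubic φ) (.ofReal q) = eLpNorm φ (.ofReal (3 * q)) ^ 3 := by
  have h := eLpNorm_norm_rpow (μ := volume) (p := .ofReal q) φ (q := 3) three_pos
  rw [← ENNReal.ofReal_mul hq, mul_comm q] at h
  rw [← ENNReal.rpow_natCast, Nat.cast_ofNat, ← h]
  refine eLpNorm_congr_norm_ae (.of_forall fun x => ?_)
  rw [norm_cubic, Real.norm_of_nonneg (by positivity)]
  exact_mod_cast (Real.rpow_natCast ‖φ x‖ 3).symm

theorem aestronglyMeasurable_cubic {φ : Space d → ℂ} (hφ : AEStronglyMeasurable φ) :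
    AEStronglyMeasurable (cubic φ) :=
  (Complex.continuous_ofReal.comp_aestronglyMeasurable (hφ.norm.pow 2)).mul hφ

theorem exists_eLpNorm_cubic_le (hd : 0 < d) {q : ℝ} (hq : 1 ≤ q)
    (h : 1 / 2 - 1 / (3 * q) ≤ s / d) :
    ∃ C : ℝ≥0, ∀ φ : Space d → ℂ, MemH s φ →
      MemLp (cubic φ) (.ofReal q) ∧ eLpNorm (cubic φ) (.ofReal q) ≤ C * normH s φ ^ 3 := by
  obtain ⟨C, sobolev⟩ := exists_eLpNorm_le_of_isBesselOf hd (by linarith) h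
  refine ⟨C ^ 3, fun φ ⟨v, hv, hφv⟩ => ?_⟩
  have norm_le : eLpNorm (cubic φ) (.ofReal q) ≤ (C ^ 3 : ℝ≥0) * normH s φ ^ 3 := by
    rw [normH, hφv.normW_eq hv, eLpNorm_cubic φ (by linarith), ENNReal.coe_pow, ← mul_pow]
    exact pow_le_pow_left' (sobolev φ v hφv hv) 3
  refine ⟨⟨aestronglyMeasurable_cubic hφv.locallyIntegrable.aestronglyMeasurable,
    norm_le.trans_lt ?_⟩, norm_le⟩
  rw [normH, hφv.normW_eq hv]
  exact ENNReal.mul_lt_top ENNReal.coe_lt_top (ENNReal.pow_lt_top hv.eLpNorm_lt_top)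

theorem exists_normW_neg_le (hd : 0 < d) {σ q r : ℝ} (hσ : 0 < σ) (hq : 1 ≤ q) (hqr : q ≤ r)
    (h : 1 / q - 1 / r < σ / d) :
    ∃ C : ℝ≥0, ∀ f : Space d → ℂ, MemLp f (.ofReal q) →
      MemW (-σ) (.ofReal r) f ∧ normW (-σ) (.ofReal r) f ≤ C * eLpNorm f (.ofReal q) := by
  obtain ⟨C, smoothing⟩ := exists_bessel_isGivenBy hd hσ hq hqr h
  refine ⟨C, fun f hf => ?_⟩
  have : Fact (1 ≤ ENNReal.ofReal q) := ⟨ENNReal.one_le_ofReal.2 hq⟩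
  have given_f := isGivenBy_toLp hf
  obtain ⟨v, given_v, hv, norm_v⟩ := smoothing _ f given_f hf
  have hfv : IsBesselOf (-σ) f v := ⟨_, given_f, given_v⟩
  exact ⟨⟨v, hv, hfv⟩, (hfv.normW_eq hv).trans_le norm_v⟩

theorem exists_cubic_exponent {d s σ r : ℝ} (hd : 0 < d) (hσ : 0 < σ) (hr : 1 ≤ r)
    (hs : d / 6 ≤ s) (h : 3 * (d / 2 - s) < d / r + σ) :
    ∃ q, 1 ≤ q ∧ q ≤ r ∧ 1 / 2 - 1 / (3 * q) ≤ s / d ∧ 1 / q - 1 / r < σ / d := by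
  have hr0 : 0 < r := by linarith
  have hs' : 1 / 6 ≤ s / d := by rw [le_div_iff₀ hd]; linarith
  have h' : 3 / 2 - 3 * (s / d) < 1 / r + σ / d := by
    rw [← mul_lt_mul_iff_right₀ hd]
    calc d * (3 / 2 - 3 * (s / d)) = 3 * (d / 2 - s) := by field_simp
      _ < d / r + σ := h
      _ = d * (1 / r + σ / d) := by field_simp
  let z := max (1 / r) (3 / 2 - 3 * (s / d))
  have hz0 : 0 < z := lt_max_of_lt_left (by positivity)
  have hz1 : z ≤ 1 := max_le ((div_le_one hr0).2 hr) (by linarith)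
  refine ⟨1 / z, (one_le_div hz0).2 hz1, ?_, ?_, ?_⟩
  · exact (one_div_le hz0 hr0).2 (le_max_left _ _)
  · have e : 1 / (3 * (1 / z)) = z / 3 := by field_simp
    rw [e]
    linarith [le_max_right (1 / r) (3 / 2 - 3 * (s / d))]
  · rw [one_div_one_div, sub_lt_iff_lt_add']
    exact max_lt (lt_add_of_pos_right _ (by positivity)) h'

theorem div_rExp (hd : 0 < d) {ε : ℝ} : d / rExp d ε = d / 2 + 1 - ε := by
  have hd0 : (d : ℝ) ≠ 0 := by exact_mod_cast hd.ne'
  rw [rExp, div_div_eq_mul_div]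
  field_simp
  ring

theorem one_le_rExp {ε : ℝ} (hε : ε < (d + 2) / 2) (hε' : 1 - ε ≤ d / 2) : 1 ≤ rExp d ε := by
  rw [rExp, one_le_div (by linarith)]
  linarith

end Cubic

end CubicSobolev

theorem lemma5p5_general {d : ℕ} (hd : 0 < d) {s σ r : ℝ} (hσ : 0 < σ) (hr : 1 ≤ r)
    (hs : d / 6 ≤ s) (h : 3 * (d / 2 - s) < d / r + σ) :
    ∃ C : ℝ≥0, ∀ φ : CubicSobolev.Space d → ℂ, CubicSobolev.MemH s φ →
      CubicSobolev.MemW (-σ) (.ofReal r) (CubicSobolev.cubic φ) ∧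
      CubicSobolev.normW (-σ) (.ofReal r) (CubicSobolev.cubic φ)
        ≤ C * CubicSobolev.normH s φ ^ 3 := by
  obtain ⟨q, hq, hqr, h_sobolev, h_smoothing⟩ :=
    CubicSobolev.exists_cubic_exponent (by exact_mod_cast hd) hσ hr hs h
  obtain ⟨C₁, cubic_le⟩ := CubicSobolev.exists_eLpNorm_cubic_le hd hq h_sobolev
  obtain ⟨C₂, normW_le⟩ := CubicSobolev.exists_normW_neg_le hd hσ hq hqr h_smoothing
  refine ⟨C₂ * C₁, fun φ hφ => ?_⟩
  obtain ⟨memLp_cubic, eLpNorm_cubic_le⟩ := cubic_le φ hφ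
  obtain ⟨memW, normW_cubic_le⟩ := normW_le _ memLp_cubic
  refine ⟨memW, normW_cubic_le.trans ?_⟩
  rw [ENNReal.coe_mul, mul_assoc]
  exact mul_right_mono eLpNorm_cubic_le

theorem lemma5p5 :
    (∀ d : ℕ, 3 ≤ d → ∀ ε : ℝ, 0 < ε → ε < ((d : ℝ) + 2) / 2 →
      ∃ C : ℝ≥0, ∀ φ : CubicSobolev.Space d → ℂ,
        CubicSobolev.MemH (CubicSobolev.sCrit d + ε) φ →
          CubicSobolev.MemW (-(CubicSobolev.sCrit d + ε / 2))
            (ENNReal.ofReal (CubicSobolev.rExp d ε)) (CubicSobolev.cubic φ) ∧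
          CubicSobolev.normW (-(CubicSobolev.sCrit d + ε / 2))
            (ENNReal.ofReal (CubicSobolev.rExp d ε)) (CubicSobolev.cubic φ)
              ≤ C * CubicSobolev.normH (CubicSobolev.sCrit d + ε) φ ^ 3) ∧
    (∀ ε : ℝ, 0 < ε → ε < 2 / 9 →
      ∃ C : ℝ≥0, ∀ φ : CubicSobolev.Space 2 → ℂ,
        CubicSobolev.MemH (1 / 3) φ →
          CubicSobolev.MemW (-(1 / 3 - ε / 2))
            (ENNReal.ofReal (CubicSobolev.rExp 2 ε)) (CubicSobolev.cubic φ) ∧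
          CubicSobolev.normW (-(1 / 3 - ε / 2))
            (ENNReal.ofReal (CubicSobolev.rExp 2 ε)) (CubicSobolev.cubic φ)
              ≤ C * CubicSobolev.normH (1 / 3) φ ^ 3) := by
  refine ⟨fun d hd ε hε hε' => ?_, fun ε hε hε' => ?_⟩
  · have hd3 : (3 : ℝ) ≤ d := by exact_mod_cast hd
    refine lemma5p5_general (by omega) ?_ (CubicSobolev.one_le_rExp hε' (by linarith)) ?_ ?_ <;>
      simp only [CubicSobolev.div_rExp (show 0 < d by omega), CubicSobolev.sCrit] <;> linarith
  · refine lemma5p5_general two_pos (by linarith) ?_ (by norm_num) ?_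
    · exact CubicSobolev.one_le_rExp (by push_cast; linarith) (by push_cast; linarith)
    · rw [CubicSobolev.div_rExp two_pos]
      push_cast
      linarith
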